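/- Let $U\subseteq\mathbb{R}^d$ be a finite set. A sample over $U$ is a set of examples $(u,y)\in U\times\{\pm1\}$. In the problem of learning halfspaces over $U$, Alice and Bob hold samples $S_a,S_b$ over $U$ such that some halfspace contains every $u$ with $(u,+1)\in S_a\cup S_b$ and no $u$ with $(u,-1)\in S_a\cup S_b$; they must output a function $f:U\to\{\pm1\}$ with $f(u)=y$ for every $(u,y)\in S_a\cup S_b$. The function $f$ is not required to be the indicator of a halfspace (improper learning is allowed). A deterministic protocol is a finite binary tree in which each internal node belongs to Alice or to Bob, who sends one bit depending on the node and on her or his own input, and each leaf is labelled by an output; its communication complexity is the depth of the tree. **Theorem (Upper bound).** There is an absolute constant $C>0$ such that for all integers $d\ge 1$ and $n\ge 0$ and every set $U\subseteq\mathbb{R}^d$ with $n$ points there is a deterministic protocol for learning halfspaces over $U$ with communication complexity at most $C\, d\log(d+1)\log(n+1)$. In particular, for $d,n\ge 2$ the communication complexity is $O(d\log d\log n)$. -/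

import Mathlib

namespace HalfspaceLearning

/-- A deterministic two-party communication protocol (Yao's model): a finite binary tree. An
internal node is owned by Alice or by Bob, who sends one bit that is a function of her or his own
input and of the node (that is, of the bits sent so far); a leaf carries the common output. -/
inductive Protocol (X Y Z : Type) : Type where
  | leaf (z : Z) : Protocol X Y Z
  | alice (bit : X → Bool) (next : Bool → Protocol X Y Z) : Protocol X Y Z
  | bob (bit : Y → Bool) (next : Bool → Protocol X Y Z) : Protocol X Y Z

namespace Protocol

variable {X Y Z : Type}

/-- The output of the protocol when Alice holds `x` and Bob holds `y`. -/
def run : Protocol X Y Z → X → Y → Z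
  | leaf z, _, _ => z
  | alice bit next, x, y => (next (bit x)).run x y
  | bob bit next, x, y => (next (bit y)).run x y

/-- The communication complexity of the protocol: the depth of the tree, that is, the largest
number of bits sent along any branch. -/
def cost : Protocol X Y Z → ℕ
  | leaf _ => 0
  | alice _ next => 1 + max (next false).cost (next true).cost
  | bob _ next => 1 + max (next false).cost (next true).cost

end Protocol

/-- A halfspace of `ℝ^d`. -/
def IsHalfspace {d : ℕ} (H : Set (EuclideanSpace ℝ (Fin d))) : Prop :=
  ∃ (w : EuclideanSpace ℝ (Fin d)) (b : ℝ), w ≠ 0 ∧ H = {x | b ≤ inner ℝ w x}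

/-- A sample over `U`: a set of examples `(u, y)` with `u ∈ U` and label `y ∈ {±1}`
(the group of units of `ℤ` is `{1, -1}`). -/
abbrev Sample {d : ℕ} (U : Finset (EuclideanSpace ℝ (Fin d))) : Type := Set (U × ℤˣ)

/-- Some halfspace contains all positive examples of `S` and no negative example of `S`. -/
def Separable {d : ℕ} {U : Finset (EuclideanSpace ℝ (Fin d))} (S : Sample U) : Prop :=
  ∃ H : Set (EuclideanSpace ℝ (Fin d)), IsHalfspace H ∧
    (∀ u : U, (u, 1) ∈ S → (u : EuclideanSpace ℝ (Fin d)) ∈ H) ∧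
    (∀ u : U, (u, -1) ∈ S → (u : EuclideanSpace ℝ (Fin d)) ∉ H)

/-- The protocol learns halfspaces over `U` (possibly improperly: the classifier that it outputs
is an arbitrary function `U → {±1}`): whenever the union of the two samples is separated by a
halfspace, the output agrees with every example of Alice and of Bob. -/
def LearnsHalfspaces {d : ℕ} {U : Finset (EuclideanSpace ℝ (Fin d))}
    (P : Protocol (Sample U) (Sample U) (U → ℤˣ)) : Prop :=
  ∀ Sa Sb : Sample U, Separable (Sa ∪ Sb) →
    ∀ e ∈ Sa ∪ Sb, P.run Sa Sb e.1 = e.2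

end HalfspaceLearning

namespace HalfspaceLearning

open Finset

/-! Separable samples on `U` are strictly separated by an affine functional without zeros on `U`;
these functionals restrict to a space `F` of dimension at most D = d + 1. The heart is a container
theorem, `exists_containers`: D^O(D) sets, a number independent of n, suffice for every positivity
set with at most half of the points to lie in one of them that has at most 3/4 of the points. One
side of a separator is light, so one of the players can name, with O(D log D) bits, a container of
her or his own points. Outside it the other player's label is safe; inside it the game repeats, for
O(log n) rounds (`exists_protocol_separating`).

For the containers, a net `V` of poly(D) points (`exists_net`) meets every large wedge {r > 0 > r'}
between two vertices, the members of `F` determined up to scaling by their zeros in `V`. The closed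
cell of the sign pattern of p on `V` contains p as a nonnegative combination of vertices taken from
a flag of faces (`exists_flag`); the container is the union of their positivity sets. A point of it
with p < 0 lies in a wedge between two of these vertices. Both belong to one cell, so the wedge
misses `V` and is small. The flag is what saves a factor: it is coded by the pattern and D points of
`V` in all, whereas unrelated vertices would need D points each.

This separates Alice's positive points from Bob's negative ones. `exists_protocol_consistent` also
treats the opposite pair of labels and exchanges one pattern fitting each sample, at a cost of O(D
log n). -/

open scoped Classical in
theorem card_powerset_filter_card_le {α : Type*} (V : Finset α) (D : ℕ) :
    #{s ∈ V.powerset | #s ≤ D} ≤ (#V + 1) ^ D := by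
  -- A set of at most D points is a list of length D in which `none` fills the unused places.
  have h : #(univ : Finset (Fin D → Option V)) = (#V + 1) ^ D := by simp
  rw [← h]
  refine Finset.card_le_card_of_surjOn
    (fun f => V.filter (fun a => ∃ i, ∃ b : V, f i = some b ∧ b = a)) ?_
  intro s hs
  simp only [coe_filter, mem_powerset, Set.mem_ofPred_eq] at hs
  obtain ⟨hsV, hsD⟩ := hs
  refine ⟨fun i => if h : (i : ℕ) < #s then
    some ⟨s.equivFin.symm ⟨i, h⟩, hsV (s.equivFin.symm ⟨i, h⟩).2⟩ else none, by simp, ?_⟩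
  ext a
  simp only [mem_filter]
  constructor
  · rintro ⟨-, i, b, hb, rfl⟩
    split_ifs at hb with h
    simp only [Option.some.injEq] at hb
    rw [← hb]
    exact (s.equivFin.symm ⟨i, h⟩).2
  · intro ha
    refine ⟨hsV ha, ⟨s.equivFin ⟨a, ha⟩, (s.equivFin ⟨a, ha⟩).2.trans_le hsD⟩, ⟨a, hsV ha⟩, ?_, rfl⟩
    simp

/-! ### Sign patterns of a finite-dimensional space of functions -/

section Subspace

variable {ι : Type*} (F : Submodule ℝ (ι → ℝ))

open scoped Classical in
/-- The sign patterns that the members of `F` leave on `V`. -/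
noncomputable def traces (V : Finset ι) : Finset (Finset ι) :=
  {W ∈ V.powerset | ∃ p ∈ F, ∀ i ∈ V, i ∈ W ↔ 0 < p i}

-- On more points than the dimension, the values of members of `F` satisfy a nontrivial linear
-- relation c. A member that is positive exactly where c is positive would give this relation a
-- positive value.
open scoped Classical in
theorem card_le_finrank_of_shatters [Finite ι] {V s : Finset ι} (hs : (traces F V).Shatters s) :
    #s ≤ Module.finrank ℝ F := by
  by_contra! hlt
  let e : F →ₗ[ℝ] (s → ℝ) := (LinearMap.funLeft ℝ ℝ (Subtype.val : s → ι)).comp F.subtype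
  have hne : LinearMap.range e ≠ ⊤ := by
    intro h
    have h1 := LinearMap.finrank_range_le e
    rw [h, finrank_top] at h1
    simp at h1
    omega
  obtain ⟨g, hg0, hg⟩ := Submodule.exists_le_ker_of_lt_top _ (lt_top_iff_ne_top.2 hne)
  have hgsum : ∀ p ∈ F, ∑ i : s, g (Pi.single i 1) * p i = 0 := by
    intro p hp
    have h1 : g (e ⟨p, hp⟩) = 0 := hg ⟨_, rfl⟩
    rw [LinearMap.pi_apply_eq_sum_univ g] at h1
    rw [← h1]
    refine Finset.sum_congr rfl fun i _ => ?_
    simp only [smul_eq_mul, mul_comm (g _)]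
    congr 2
    funext j
    simp [Pi.single_apply, eq_comm]
  -- The sign is chosen so that some coefficient is positive; this makes the final sum strictly
  -- positive.
  obtain ⟨c, hc, i₀, hi₀⟩ : ∃ c : s → ℝ, (∀ p ∈ F, ∑ i : s, c i * p i = 0) ∧ ∃ i, 0 < c i := by
    obtain ⟨i, hi⟩ : ∃ i, g (Pi.single i 1) ≠ 0 := by
      by_contra! h
      apply hg0
      refine LinearMap.pi_ext' fun i => ?_
      ext
      simpa using h i
    rcases lt_or_gt_of_ne hi with h | h
    · refine ⟨fun i => - g (Pi.single i 1), fun p hp => ?_, i, by simpa using h⟩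
      simp only [neg_mul, Finset.sum_neg_distrib, hgsum p hp, neg_zero]
    · exact ⟨fun i => g (Pi.single i 1), hgsum, i, h⟩
  obtain ⟨u, hu, hsu⟩ := hs (t := s.filter (fun i => ∃ h : i ∈ s, 0 < c ⟨i, h⟩)) (filter_subset _ _)
  simp only [traces, mem_filter, mem_powerset] at hu
  obtain ⟨huV, p, hp, hpu⟩ := hu
  have hsV : s ⊆ V := by
    obtain ⟨w, hw, hsw⟩ := hs (t := s) Subset.rfl
    simp only [traces, mem_filter, mem_powerset] at hw
    exact (inter_eq_left.1 hsw).trans hw.1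
  have key : ∀ i : s, 0 < p i ↔ 0 < c i := by
    intro i
    rw [← hpu i (hsV i.2)]
    have := congrArg (fun t => (i : ι) ∈ t) hsu
    simpa using this
  have hpos : 0 < ∑ i : s, c i * p i := by
    refine Finset.sum_pos' (fun i _ => ?_) ⟨i₀, mem_univ _, mul_pos hi₀ ((key i₀).2 hi₀)⟩
    by_cases h : 0 < c i
    · exact (mul_pos h ((key i).2 h)).le
    · exact mul_nonneg_of_nonpos_of_nonpos (not_lt.1 h) (not_lt.1 (mt (key i).1 h))
  exact hpos.ne' (hc p hp)

/-- Sauer–Shelah in Pajor's form: there are at most as many patterns as shattered sets, and these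
have at most D points. -/
theorem card_traces_le [Finite ι] {D : ℕ} (hF : Module.finrank ℝ F ≤ D) (V : Finset ι) :
    #(traces F V) ≤ (#V + 1) ^ D := by
  classical
  refine (card_le_card_shatterer _).trans ((card_le_card ?_).trans (card_powerset_filter_card_le V D))
  intro s hs
  rw [mem_shatterer] at hs
  have hs' := hs
  obtain ⟨w, hw, hsw⟩ := hs (t := s) Subset.rfl
  simp only [traces, mem_filter, mem_powerset] at hw
  simp only [mem_filter, mem_powerset]
  refine ⟨(inter_eq_left.1 hsw).trans hw.1, ?_⟩
  refine le_trans ?_ hF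
  convert card_le_finrank_of_shatters F (V := V) (s := s) ?_
  convert hs'

/-- The members of `F` that vanish on `J`. -/
def vanishing (J : Finset ι) : Submodule ℝ (ι → ℝ) where
  carrier := {y | y ∈ F ∧ ∀ j ∈ J, y j = 0}
  add_mem' := fun ha hb => ⟨F.add_mem ha.1 hb.1, fun j hj => by simp [ha.2 j hj, hb.2 j hj]⟩
  zero_mem' := ⟨F.zero_mem, fun _ _ => rfl⟩
  smul_mem' := fun c _ ha => ⟨F.smul_mem c ha.1, fun j hj => by simp [ha.2 j hj]⟩

theorem vanishing_le (J : Finset ι) : vanishing F J ≤ F := fun _ hy => hy.1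

/-- Few coordinates suffice to detect vanishing on `Z`. -/
theorem exists_subset_vanishing_eq [Finite ι] (Z : Finset ι) :
    ∃ T ⊆ Z, #T ≤ Module.finrank ℝ F ∧ vanishing F T = vanishing F Z := by
  classical
  -- Greedy choice: while vanishing on T is weaker than vanishing on Z, some point of Z lowers the
  -- dimension, which n bounds.
  suffices h : ∀ n, ∀ T ⊆ Z, Module.finrank ℝ (vanishing F T) ≤ n →
      ∃ T' ⊆ Z, #T' ≤ #T + n ∧ vanishing F T' = vanishing F Z by
    have := h (Module.finrank ℝ F) ∅ (by simp) (Submodule.finrank_mono (vanishing_le F ∅))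
    simpa using this
  intro n
  induction n with
  | zero =>
    intro T hT hr
    refine ⟨T, hT, by simp, ?_⟩
    have h0 : vanishing F T = ⊥ := Submodule.finrank_eq_zero.1 (Nat.le_zero.1 hr)
    rw [h0, eq_comm, eq_bot_iff, ← h0]
    exact fun y hy => ⟨hy.1, fun j hj => hy.2 j (hT hj)⟩
  | succ n ih =>
    intro T hT hr
    by_cases h : vanishing F T = vanishing F Z
    · exact ⟨T, hT, by omega, h⟩
    have hle : vanishing F Z ≤ vanishing F T := fun y hy => ⟨hy.1, fun j hj => hy.2 j (hT hj)⟩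
    obtain ⟨y, hyT, hyZ⟩ := SetLike.exists_of_lt (lt_of_le_of_ne hle (Ne.symm h))
    obtain ⟨j, hj, hyj⟩ : ∃ j ∈ Z, y j ≠ 0 := by
      by_contra! hh
      exact hyZ ⟨hyT.1, hh⟩
    have hlt : vanishing F (insert j T) < vanishing F T := by
      refine lt_of_le_of_ne (fun y hy => ⟨hy.1, fun i hi => hy.2 i (mem_insert_of_mem hi)⟩) ?_
      intro he
      rw [← he] at hyT
      exact hyj (hyT.2 j (mem_insert_self _ _))
    have := Submodule.finrank_lt_finrank_of_lt hlt
    obtain ⟨T', hT', hc, he⟩ := ih (insert j T) (insert_subset hj hT) (by omega)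
    exact ⟨T', hT', hc.trans (by have := card_insert_le j T; omega), he⟩

/-! ### Cells, their vertices and flags of faces -/

/-- The closed cone of the members of `F` with sign pattern `W` on `V` that vanish on `J`. -/
def cell (V W J : Finset ι) : Set (ι → ℝ) :=
  {y | y ∈ F ∧ (∀ i ∈ V, (i ∈ W → 0 ≤ y i) ∧ (i ∉ W → y i ≤ 0)) ∧ ∀ j ∈ J, y j = 0}

/-- A nonzero member of `F` that is determined up to scaling by its zeros in `V`. -/
def IsVertex (V : Finset ι) (r : ι → ℝ) : Prop :=
  r ∈ F ∧ r ≠ 0 ∧ ∀ z ∈ F, (∀ i ∈ V, r i = 0 → z i = 0) → ∃ c : ℝ, z = c • r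

variable {F}

/-- A nonzero element y of the cell with the most zeros in `V` is a vertex. If some z vanished at
these zeros without being a multiple of y, sliding y along z up to the first new zero would stay in
the cell and gain a zero. -/
theorem exists_isVertex_mem_cell {V W J : Finset ι}
    (hV : ∀ y ∈ F, (∀ i ∈ V, y i = 0) → y = 0)
    (hJV : J ⊆ V) (hne : ∃ y ∈ cell F V W J, y ≠ 0) : ∃ r ∈ cell F V W J, IsVertex F V r := by
  classical
  let cnt : (ι → ℝ) → ℕ := fun y => #{i ∈ V | y i = 0}
  have hn : ∀ y, cnt y ≤ #V := fun y => card_filter_le _ _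
  obtain ⟨y, ⟨hy, hy0⟩, hmax⟩ := (measure (fun y => #V - cnt y)).wf.has_min
    {y | y ∈ cell F V W J ∧ y ≠ 0} hne
  refine ⟨y, hy, hy.1, hy0, fun z hz hzy => ?_⟩
  by_contra! hc
  have hz0 : z ≠ 0 := fun h => hc 0 (by simp [h])
  obtain ⟨i, hi, himin⟩ : ∃ i ∈ V.filter (fun i => z i ≠ 0), ∀ j ∈ V.filter (fun i => z i ≠ 0),
      |y i / z i| ≤ |y j / z j| := by
    refine exists_min_image _ _ ?_
    by_contra! h
    refine hz0 (hV z hz fun i hi => ?_)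
    by_contra h1
    have : i ∈ V.filter (fun i => z i ≠ 0) := mem_filter.2 ⟨hi, h1⟩
    simp [h] at this
  obtain ⟨hiV, hzi⟩ := mem_filter.1 hi
  have hyi : y i ≠ 0 := fun h => hzi (hzy i hiV h)
  set t : ℝ := -(y i / z i) with ht
  have ht0 : t ≠ 0 := neg_ne_zero.2 (div_ne_zero hyi hzi)
  have hbound : ∀ j ∈ V, |t * z j| ≤ |y j| := by
    intro j hj
    by_cases h : z j = 0
    · simp [h]
    · have := himin j (mem_filter.2 ⟨hj, h⟩)
      rw [abs_mul, ht, abs_neg]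
      rwa [abs_div (y j), le_div_iff₀ (abs_pos.2 h)] at this
  have hJ : ∀ j ∈ J, z j = 0 := fun j hj => hzy j (hJV hj) (hy.2.2 j hj)
  refine hmax (y + t • z) ⟨⟨F.add_mem hy.1 (F.smul_mem t hz), fun j hj => ?_, fun j hj => ?_⟩, ?_⟩ ?_
  · have hb := hbound j hj
    simp only [Pi.add_apply, Pi.smul_apply, smul_eq_mul]
    constructor
    · intro h
      have h1 := (hy.2.1 j hj).1 h
      rw [abs_of_nonneg h1] at hb
      linarith [(abs_le.1 hb).1]
    · intro h
      have h1 := (hy.2.1 j hj).2 h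
      rw [abs_of_nonpos h1] at hb
      linarith [(abs_le.1 hb).2]
  · simp [hy.2.2 j hj, hJ j hj]
  · intro h
    apply hc (-t⁻¹)
    funext j
    have := congrFun h j
    simp only [Pi.add_apply, Pi.smul_apply, smul_eq_mul, Pi.zero_apply] at this ⊢
    field_simp
    linarith
  · have hlt : cnt y < cnt (y + t • z) := by
      refine card_lt_card (ssubset_iff_of_subset ?_ |>.2 ⟨i, ?_, ?_⟩)
      · intro j hj
        obtain ⟨h1, h2⟩ := mem_filter.1 hj
        exact mem_filter.2 ⟨h1, by simp [h2, hzy j h1 h2]⟩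
      · refine mem_filter.2 ⟨hiV, ?_⟩
        simp only [Pi.add_apply, Pi.smul_apply, smul_eq_mul, ht]
        field_simp
        ring
      · simp [hyi]
    have := hn (y + t • z)
    change #V - cnt (y + t • z) < #V - cnt y
    omega

open scoped Classical in
variable (F) in
/-- A vertex in the given cell, or `0` if the cell is trivial. -/
noncomputable def vtx (V W J : Finset ι) : ι → ℝ :=
  if h : ∃ r ∈ cell F V W J, IsVertex F V r then h.choose else 0

theorem vtx_mem_cell (V W J : Finset ι) : vtx F V W J ∈ cell F V W J := by
  unfold vtx
  split_ifs with h
  · exact h.choose_spec.1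
  · exact ⟨F.zero_mem, by simp, by simp⟩

theorem isVertex_vtx {V W J : Finset ι} (h : vtx F V W J ≠ 0) : IsVertex F V (vtx F V W J) := by
  unfold vtx at h ⊢
  split_ifs at h ⊢ with h1
  · exact h1.choose_spec.2
  · exact absurd rfl h

theorem cell_anti {V W J J' : Finset ι} (h : J ⊆ J') : cell F V W J' ⊆ cell F V W J :=
  fun _ hy => ⟨hy.1, hy.2.1, fun j hj => hy.2.2 j (h hj)⟩

open scoped Classical in
variable (F) in
/-- The vertices of a descending flag of faces of a cell. -/
noncomputable def flagVertices (V W : Finset ι) : Finset ι → List ι → Finset (ι → ℝ)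
  | J, [] => {vtx F V W J}
  | J, j :: l => insert (vtx F V W J) (flagVertices V W (insert j J) l)

theorem card_flagVertices_le (V W J : Finset ι) (l : List ι) :
    #(flagVertices F V W J l) ≤ l.length + 1 := by
  classical
  induction l generalizing J with
  | nil => simp [flagVertices]
  | cons j l ih =>
    rw [flagVertices, List.length_cons]
    exact (card_insert_le _ _).trans (Nat.add_le_add_right (ih _) 1)

theorem mem_flagVertices {V W J : Finset ι} {l : List ι} {r : ι → ℝ}
    (h : r ∈ flagVertices F V W J l) :
    r ∈ cell F V W J ∧ (r ≠ 0 → IsVertex F V r) := by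
  classical
  induction l generalizing J with
  | nil =>
    rw [flagVertices, mem_singleton] at h
    subst h
    exact ⟨vtx_mem_cell _ _ _, isVertex_vtx⟩
  | cons j l ih =>
    rw [flagVertices, mem_insert] at h
    rcases h with rfl | h
    · exact ⟨vtx_mem_cell _ _ _, isVertex_vtx⟩
    · exact ⟨cell_anti (subset_insert _ _) (ih h).1, (ih h).2⟩

/-- Every member of a cell is, in terms of signs, dominated by the vertices of a flag of faces. -/
theorem exists_flag [Finite ι] {V W : Finset ι} (hV : ∀ y ∈ F, (∀ i ∈ V, y i = 0) → y = 0)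
    (hVne : V.Nonempty) (n : ℕ) (J : Finset ι) (hJ : J ⊆ V) (y : ι → ℝ) (hy : y ∈ cell F V W J)
    (hn : Module.finrank ℝ (vanishing F J) ≤ n) :
    ∃ l : List ι, l.length = n ∧ (∀ j ∈ l, j ∈ V) ∧
      ∀ i, (0 < y i → ∃ r ∈ flagVertices F V W J l, 0 < r i) ∧
        (y i < 0 → ∃ r ∈ flagVertices F V W J l, r i < 0) := by
  classical
  obtain ⟨v₀, hv₀⟩ := hVne
  by_cases hy0 : y = 0
  · refine ⟨List.replicate n v₀, by simp, fun j hj => ?_, ?_⟩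
    · rw [List.eq_of_mem_replicate hj]
      exact hv₀
    · simp [hy0]
  induction n generalizing J y with
  | zero =>
    have h0 : vanishing F J = ⊥ := Submodule.finrank_eq_zero.1 (Nat.le_zero.1 hn)
    have : y ∈ vanishing F J := ⟨hy.1, hy.2.2⟩
    rw [h0] at this
    exact absurd this hy0
  | succ n ih =>
    have hex := exists_isVertex_mem_cell hV hJ ⟨y, hy, hy0⟩
    set r := vtx F V W J with hr
    have hrv : IsVertex F V r := by
      rw [hr, vtx, dif_pos hex]
      exact hex.choose_spec.2
    have hrc : r ∈ cell F V W J := vtx_mem_cell V W J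
    -- The minimal ratio s is the largest multiple of r that can be subtracted from y within the
    -- cell. The remainder vanishes at j while r does not, so it lies in a face of smaller
    -- dimension. As s ≥ 0, a sign of y at a point is a sign of r or of the remainder there.
    obtain ⟨j, hj, hjmin⟩ : ∃ j ∈ V.filter (fun i => r i ≠ 0), ∀ i ∈ V.filter (fun i => r i ≠ 0),
        y j / r j ≤ y i / r i := by
      refine exists_min_image _ _ ?_
      by_contra! h
      refine hrv.2.1 (hV r hrv.1 fun i hi => ?_)
      by_contra h1
      have : i ∈ V.filter (fun i => r i ≠ 0) := mem_filter.2 ⟨hi, h1⟩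
      simp [h] at this
    obtain ⟨hjV, hrj⟩ := mem_filter.1 hj
    set s := y j / r j with hs
    have hs0 : 0 ≤ s := by
      by_cases h : j ∈ W
      · exact div_nonneg ((hy.2.1 j hjV).1 h) ((hrc.2.1 j hjV).1 h)
      · exact div_nonneg_of_nonpos ((hy.2.1 j hjV).2 h) ((hrc.2.1 j hjV).2 h)
    have hy' : y - s • r ∈ cell F V W (insert j J) := by
      refine ⟨F.sub_mem hy.1 (F.smul_mem s hrv.1), fun i hi => ?_, fun i hi => ?_⟩
      · simp only [Pi.sub_apply, Pi.smul_apply, smul_eq_mul]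
        by_cases hri : r i = 0
        · simpa [hri] using hy.2.1 i hi
        have hmin := hjmin i (mem_filter.2 ⟨hi, hri⟩)
        constructor
        · intro h
          have h1 := lt_of_le_of_ne ((hrc.2.1 i hi).1 h) (Ne.symm hri)
          rw [le_div_iff₀ h1] at hmin
          linarith
        · intro h
          have h1 := lt_of_le_of_ne ((hrc.2.1 i hi).2 h) hri
          rw [le_div_iff_of_neg h1] at hmin
          linarith
      · simp only [Pi.sub_apply, Pi.smul_apply, smul_eq_mul]
        rcases mem_insert.1 hi with rfl | hi
        · rw [hs]; field_simp; ring
        · simp [hy.2.2 i hi, hrc.2.2 i hi]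
    have hlt : vanishing F (insert j J) < vanishing F J := by
      refine lt_of_le_of_ne (fun y hy => ⟨hy.1, fun i hi => hy.2 i (mem_insert_of_mem hi)⟩) ?_
      intro he
      have h1 : r ∈ vanishing F J := ⟨hrc.1, hrc.2.2⟩
      rw [← he] at h1
      exact hrj (h1.2 j (mem_insert_self _ _))
    have hrank := Submodule.finrank_lt_finrank_of_lt hlt
    obtain ⟨l, hl, hlV, hls⟩ : ∃ l : List ι, l.length = n ∧ (∀ j ∈ l, j ∈ V) ∧
      ∀ i, (0 < (y - s • r) i → ∃ r ∈ flagVertices F V W (insert j J) l, 0 < r i) ∧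
        ((y - s • r) i < 0 → ∃ r ∈ flagVertices F V W (insert j J) l, r i < 0) := by
      by_cases h0 : y - s • r = 0
      · refine ⟨List.replicate n v₀, by simp, fun j hj => ?_, ?_⟩
        · rw [List.eq_of_mem_replicate hj]
          exact hv₀
        · rw [h0]
          simp
      · exact ih _ (insert_subset hjV hJ) _ hy' (by omega) h0
    refine ⟨j :: l, by simp [hl], ?_, fun i => ?_⟩
    · intro k hk
      rcases List.mem_cons.1 hk with rfl | hk
      · exact hjV
      · exact hlV k hk
    · obtain ⟨h1, h2⟩ := hls i
      simp only [Pi.sub_apply, Pi.smul_apply, smul_eq_mul] at h1 h2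
      rw [flagVertices]
      constructor
      · intro hyi
        by_cases hri : 0 < r i
        · exact ⟨r, mem_insert_self _ _, hri⟩
        · obtain ⟨q, hq, hqi⟩ := h1 (by nlinarith)
          exact ⟨q, mem_insert_of_mem hq, hqi⟩
      · intro hyi
        by_cases hri : r i < 0
        · exact ⟨r, mem_insert_self _ _, hri⟩
        · obtain ⟨q, hq, hqi⟩ := h2 (by nlinarith)
          exact ⟨q, mem_insert_of_mem hq, hqi⟩

end Subspace

/-! ### Hitting sets by random sampling -/

/-- A random sample hits every large set of a family in which each set depends on few of the
sampled points. -/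
theorem exists_sample_hitting {ι Q : Type*} [Fintype ι] [Nonempty ι] [Fintype Q] [DecidableEq ι]
    (N k : ℕ) (R : Q → Finset (Fin N)) (hR : ∀ q, #(R q) ≤ k)
    (S : Q → (Fin N → ι) → Finset ι)
    (hS : ∀ q x x', (∀ i ∈ R q, x i = x' i) → S q x = S q x')
    (ρ : ℝ) (hρ0 : 0 ≤ ρ) (hρ1 : ρ ≤ 1) (hlt : Fintype.card Q * ρ ^ (N - k) < 1) :
    ∃ x : Fin N → ι, ∀ q, ρ * Fintype.card ι < #(S q x)ᶜ ∨ ∃ i, x i ∈ S q x := by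
  classical
  by_contra! hcon
  set m := Fintype.card ι with hm
  have hmpos : (0 : ℝ) < m := by exact_mod_cast Fintype.card_pos
  let bad : Q → Finset (Fin N → ι) := fun q =>
    {x | (#(S q x)ᶜ : ℝ) ≤ ρ * m ∧ ∀ i, x i ∉ S q x}
  have hbad : ∀ q, (#(bad q) : ℝ) ≤ m ^ N * ρ ^ (N - k) := by
    intro q
    set c := ⌊ρ * m⌋₊ with hc
    have hcle : (c : ℝ) ≤ ρ * m := Nat.floor_le (by positivity)
    -- Once the coordinates in `R q` are fixed, so is the set `S q x`; the other coordinates must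
    -- all fall in its complement, which has at most c points.
    have hfib : #(bad q) ≤ c ^ (N - #(R q)) *
        #((bad q).image (fun x => fun i : R q => x i)) := by
      refine card_le_mul_card_image _ _ fun y _ => ?_
      by_cases hne : ((bad q).filter (fun x => (fun i : R q => x i) = y)).Nonempty
      · obtain ⟨x₀, hx₀⟩ := hne
        obtain ⟨hx₀b, hx₀y⟩ := mem_filter.1 hx₀
        have hsub : (bad q).filter (fun x => (fun i : R q => x i) = y) ⊆
            Fintype.piFinset (fun i => if i ∈ R q then {x₀ i} else (S q x₀)ᶜ) := by
          intro x hx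
          obtain ⟨hxb, hxy⟩ := mem_filter.1 hx
          have hagree : ∀ i ∈ R q, x i = x₀ i := fun i hi =>
            congrFun (hxy.trans hx₀y.symm) ⟨i, hi⟩
          rw [Fintype.mem_piFinset]
          intro i
          split_ifs with hi
          · simp [hagree i hi]
          · rw [mem_compl, ← hS q x x₀ hagree]
            exact (mem_filter.1 hxb).2.2 i
        refine (card_le_card hsub).trans ?_
        rw [Fintype.card_piFinset]
        have hcard : ∀ i, #(if i ∈ R q then {x₀ i} else (S q x₀)ᶜ) =
            if i ∈ R q then 1 else #(S q x₀)ᶜ := by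
          intro i
          split_ifs <;> simp
        simp only [hcard, prod_ite, prod_const_one, one_mul, prod_const]
        have hN : #{i | i ∉ R q} = N - #(R q) := by
          rw [← compl_filter, card_compl]
          simp
        rw [hN]
        refine Nat.pow_le_pow_left ?_ _
        exact Nat.le_floor (mem_filter.1 hx₀b).2.1
      · rw [not_nonempty_iff_eq_empty.1 hne]
        simp
    have himg : #((bad q).image (fun x => fun i : R q => x i)) ≤ m ^ #(R q) := by
      refine (card_le_univ _).trans ?_
      simp [hm]
    have hRN : #(R q) ≤ N := by simpa using card_le_univ (R q)
    calc (#(bad q) : ℝ) ≤ (c : ℝ) ^ (N - #(R q)) * (m : ℝ) ^ #(R q) := by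
          exact_mod_cast hfib.trans (Nat.mul_le_mul_left _ himg)
      _ ≤ (ρ * m) ^ (N - #(R q)) * (m : ℝ) ^ #(R q) := by gcongr
      _ = m ^ N * ρ ^ (N - #(R q)) := by
          rw [mul_pow, mul_assoc, ← pow_add, Nat.sub_add_cancel hRN, mul_comm]
      _ ≤ m ^ N * ρ ^ (N - k) := by
          gcongr ?_ * ?_
          exact pow_le_pow_of_le_one hρ0 hρ1 (Nat.sub_le_sub_left (hR q) N)
  have hcover : (univ : Finset (Fin N → ι)) ⊆ univ.biUnion bad := by
    intro x _
    obtain ⟨q, hq⟩ := hcon x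
    exact mem_biUnion.2 ⟨q, mem_univ _, mem_filter.2 ⟨mem_univ _, hq⟩⟩
  have h1 : ((m : ℝ)) ^ N ≤ ∑ q, (#(bad q) : ℝ) := by
    have := (card_le_card hcover).trans card_biUnion_le
    rw [card_univ, Fintype.card_fun, Fintype.card_fin] at this
    exact_mod_cast this
  have h2 : ∑ q, (#(bad q) : ℝ) ≤ m ^ N * (Fintype.card Q * ρ ^ (N - k)) := by
    refine (sum_le_sum fun q _ => hbad q).trans (le_of_eq ?_)
    rw [sum_const, card_univ, nsmul_eq_mul]
    ring
  have h3 : (0 : ℝ) < m ^ N := by positivity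
  nlinarith

/-! ### Nets and containers -/

section Subspace

variable {ι : Type*} (F : Submodule ℝ (ι → ℝ))

open scoped Classical in
/-- A generator of the space of members of `F` that vanish on `T`, if that space is a line. -/
noncomputable def lineGenerator (T : Finset ι) : ι → ℝ :=
  if h : ∃ r : ι → ℝ, r ≠ 0 ∧ vanishing F T = Submodule.span ℝ {r} then h.choose else 0

variable {F}

/-- At most D zeros in `V` already cut out the line of a vertex. Hence a vertex is coded by at most
D points of `V` and a sign, as far as its signs are concerned. -/
theorem IsVertex.eq_smul_lineGenerator [Finite ι] {D : ℕ} (hF : Module.finrank ℝ F ≤ D)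
    {V : Finset ι} {r : ι → ℝ} (hr : IsVertex F V r) :
    ∃ T ⊆ V, #T ≤ D ∧ ∃ c : ℝ, c ≠ 0 ∧ r = c • lineGenerator F T := by
  classical
  obtain ⟨T, hT, hcard, hvan⟩ := exists_subset_vanishing_eq F {i ∈ V | r i = 0}
  have hspan : vanishing F T = Submodule.span ℝ {r} := by
    rw [hvan]
    ext z
    rw [Submodule.mem_span_singleton]
    constructor
    · intro hz
      obtain ⟨c, hc⟩ := hr.2.2 z hz.1 fun i hi hri => hz.2 i (mem_filter.2 ⟨hi, hri⟩)
      exact ⟨c, hc.symm⟩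
    · rintro ⟨c, rfl⟩
      exact ⟨F.smul_mem c hr.1, fun i hi => by simp [(mem_filter.1 hi).2]⟩
  have hex : ∃ r : ι → ℝ, r ≠ 0 ∧ vanishing F T = Submodule.span ℝ {r} := ⟨r, hr.2.1, hspan⟩
  refine ⟨T, hT.trans (filter_subset _ _), hcard.trans hF, ?_⟩
  have hmem : r ∈ Submodule.span ℝ {lineGenerator F T} := by
    rw [lineGenerator, dif_pos hex, ← hex.choose_spec.2, hspan]
    exact Submodule.mem_span_singleton_self r
  obtain ⟨c, hc⟩ := Submodule.mem_span_singleton.1 hmem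
  refine ⟨c, ?_, hc.symm⟩
  rintro rfl
  exact hr.2.1 (by rw [← hc, zero_smul])

/-- The union bound for the net: there are 4(N + D + 1)^(2D) wedges at most, with N = 2D + 64(D +
1)^4, and each one leaves N - 2D free samples. Since ρ^(4(D + 1)^2) ≤ 1/2, the failure probability
is at most 2^(-16(D + 1)^2), against at most 2^(8D² + 14D + 2) wedges. -/
theorem sample_size_bound (D : ℕ) :
    (4 : ℝ) * (2 * D + 64 * (D + 1) ^ 4 + D + 1) ^ (2 * D) *
      (1 - 1 / (4 * ((D : ℝ) + 1) ^ 2)) ^ (64 * (D + 1) ^ 4) < 1 := by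
  set ρ : ℝ := 1 - 1 / (4 * ((D : ℝ) + 1) ^ 2) with hρ
  have hq : (1 : ℝ) ≤ 4 * ((D : ℝ) + 1) ^ 2 := by nlinarith [(Nat.cast_nonneg D : (0 : ℝ) ≤ D)]
  have hρ0 : 0 ≤ ρ := by
    rw [hρ, sub_nonneg, div_le_one (by positivity)]
    exact hq
  have hhalf : ρ ^ (4 * (D + 1) ^ 2) ≤ 1 / 2 := by
    have h1 : ρ ≤ Real.exp (-(1 / (4 * ((D : ℝ) + 1) ^ 2))) := by
      have := Real.add_one_le_exp (-(1 / (4 * ((D : ℝ) + 1) ^ 2)))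
      rw [hρ]; linarith
    calc ρ ^ (4 * (D + 1) ^ 2) ≤ Real.exp (-(1 / (4 * ((D : ℝ) + 1) ^ 2))) ^ (4 * (D + 1) ^ 2) := by
          gcongr
      _ = Real.exp (-1) := by
          rw [← Real.exp_nat_mul]
          congr 1
          push_cast
          field_simp
      _ ≤ 1 / 2 := by
          rw [Real.exp_neg, ← one_div]
          refine one_div_le_one_div_of_le (by norm_num) ?_
          have := Real.add_one_le_exp (1 : ℝ)
          linarith
  have hpow : ρ ^ (64 * (D + 1) ^ 4) ≤ (1 / 2) ^ (16 * (D + 1) ^ 2) := by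
    calc ρ ^ (64 * (D + 1) ^ 4) = (ρ ^ (4 * (D + 1) ^ 2)) ^ (16 * (D + 1) ^ 2) := by
          rw [← pow_mul]; ring_nf
      _ ≤ _ := by gcongr
  have hD : (D : ℝ) + 1 ≤ 2 ^ D := by exact_mod_cast Nat.lt_two_pow_self (n := D)
  have hbase : (2 * D + 64 * (D + 1) ^ 4 + D + 1 : ℝ) ≤ 2 ^ (7 + 4 * D) := by
    have h0 : (0 : ℝ) ≤ D := Nat.cast_nonneg D
    calc (2 * D + 64 * (D + 1) ^ 4 + D + 1 : ℝ) ≤ 128 * (D + 1) ^ 4 := by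
          nlinarith [one_le_pow₀ (n := 3) (by linarith : (1 : ℝ) ≤ D + 1),
            (by ring : ((D : ℝ) + 1) ^ 4 = (D + 1) ^ 3 * (D + 1))]
      _ ≤ 128 * (2 ^ D) ^ 4 := by gcongr
      _ = 2 ^ (7 + 4 * D) := by rw [pow_add, mul_comm 4 D, pow_mul]; norm_num
  calc _ ≤ (4 : ℝ) * (2 ^ (7 + 4 * D)) ^ (2 * D) * (1 / 2) ^ (16 * (D + 1) ^ 2) := by gcongr
    _ = 2 ^ (2 + (7 + 4 * D) * (2 * D)) * (1 / 2) ^ (16 * (D + 1) ^ 2) := by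
        rw [← pow_mul, pow_add 2 2]; norm_num
    _ < 2 ^ (16 * (D + 1) ^ 2) * (1 / 2) ^ (16 * (D + 1) ^ 2) := by
        gcongr
        · norm_num
        · nlinarith
    _ = 1 := by rw [← mul_pow]; norm_num

/-- A small set of points that determines `F` and meets each large wedge between two vertices. -/
theorem exists_net [Fintype ι] [Nonempty ι] {D : ℕ} (hF : Module.finrank ℝ F ≤ D) :
    ∃ V : Finset ι, V.Nonempty ∧ #V ≤ 3 * D + 64 * (D + 1) ^ 4 ∧
      (∀ y ∈ F, (∀ i ∈ V, y i = 0) → y = 0) ∧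
      ∀ r r', IsVertex F V r → IsVertex F V r' → (∀ i ∈ V, 0 < r i → 0 ≤ r' i) →
        4 * (D + 1) ^ 2 * #{i | 0 < r i ∧ r' i < 0} ≤ Fintype.card ι := by
  classical
  -- `B` makes restriction to the net injective on `F`; the random points are added to it.
  obtain ⟨B, -, hBcard, hB⟩ := exists_subset_vanishing_eq F univ
  set N := 2 * D + 64 * (D + 1) ^ 4 with hN
  let ext : (Fin N → ι) → Fin N ⊕ B → ι := fun x => Sum.elim x Subtype.val
  let 𝒮 : Finset (Finset (Fin N ⊕ B)) := {s ∈ univ.powerset | #s ≤ D}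
  have h𝒮 : #𝒮 ≤ (N + D + 1) ^ D := by
    refine (card_powerset_filter_card_le univ D).trans (Nat.pow_le_pow_left ?_ _)
    simp
    omega
  let sgn : Bool → ℝ := fun b => if b then 1 else -1
  -- Wedges are indexed by positions in the sample, not by points, so the index set is fixed before
  -- sampling; the Booleans are the signs of the two generators.
  let Q := (𝒮 × 𝒮) × (Bool × Bool)
  let R : Q → Finset (Fin N) := fun q => q.1.1.1.toLeft ∪ q.1.2.1.toLeft
  let S : Q → (Fin N → ι) → Finset ι := fun q x =>
    {i | 0 < sgn q.2.1 * lineGenerator F (q.1.1.1.image (ext x)) i ∧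
      sgn q.2.2 * lineGenerator F (q.1.2.1.image (ext x)) i < 0}
  have hR : ∀ q, #(R q) ≤ 2 * D := by
    intro q
    have h1 := (mem_filter.1 q.1.1.2).2
    have h2 := (mem_filter.1 q.1.2.2).2
    have h3 := card_toLeft_le (u := q.1.1.1)
    have h4 := card_toLeft_le (u := q.1.2.1)
    have := card_union_le q.1.1.1.toLeft q.1.2.1.toLeft
    change #(q.1.1.1.toLeft ∪ q.1.2.1.toLeft) ≤ 2 * D
    omega
  have hS : ∀ q x x', (∀ i ∈ R q, x i = x' i) → S q x = S q x' := by
    intro q x x' h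
    have himg : ∀ A : Finset (Fin N ⊕ B), A.toLeft ⊆ R q → A.image (ext x) = A.image (ext x') := by
      intro A hA
      refine image_congr fun a ha => ?_
      cases a with
      | inl a => exact h a (hA (mem_toLeft.2 ha))
      | inr a => rfl
    simp only [S]
    rw [himg _ subset_union_left, himg _ subset_union_right]
  obtain ⟨x, hx⟩ := exists_sample_hitting N (2 * D) R hR S hS (1 - 1 / (4 * ((D : ℝ) + 1) ^ 2))
    (by
      rw [sub_nonneg, div_le_one (by positivity)]
      nlinarith [(Nat.cast_nonneg D : (0 : ℝ) ≤ D)])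
    (by
      rw [sub_le_self_iff]
      positivity)
    (by
      refine lt_of_le_of_lt ?_ (sample_size_bound D)
      rw [show N - 2 * D = 64 * (D + 1) ^ 4 by omega]
      have hρ : (0 : ℝ) ≤ 1 - 1 / (4 * ((D : ℝ) + 1) ^ 2) := by
        rw [sub_nonneg, div_le_one (by positivity)]
        nlinarith [(Nat.cast_nonneg D : (0 : ℝ) ≤ D)]
      refine mul_le_mul_of_nonneg_right ?_ (by positivity)
      have hQ : Fintype.card Q ≤ 4 * (N + D + 1) ^ (2 * D) := by
        simp only [Q, Fintype.card_prod, Fintype.card_coe, Fintype.card_bool]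
        calc #𝒮 * #𝒮 * (2 * 2) ≤ (N + D + 1) ^ D * (N + D + 1) ^ D * (2 * 2) := by gcongr
          _ = _ := by rw [two_mul D, pow_add]; ring
      have : (Fintype.card Q : ℝ) ≤ ((4 * (N + D + 1) ^ (2 * D) : ℕ) : ℝ) := by exact_mod_cast hQ
      refine this.trans (le_of_eq ?_)
      rw [hN]
      push_cast
      ring)
  have hNpos : 0 < N := by positivity
  refine ⟨univ.image (ext x), ⟨x ⟨0, hNpos⟩, mem_image.2 ⟨Sum.inl ⟨0, hNpos⟩, mem_univ _, rfl⟩⟩,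
    ?_, ?_, ?_⟩
  · refine card_image_le.trans ?_
    simp
    omega
  · intro y hy hyV
    have : y ∈ vanishing F B := ⟨hy, fun j hj =>
      hyV j (mem_image.2 ⟨Sum.inr ⟨j, hj⟩, mem_univ _, rfl⟩)⟩
    rw [hB] at this
    funext j
    exact this.2 j (mem_univ _)
  · intro r r' hr hr' hno
    have key : ∀ r, IsVertex F (univ.image (ext x)) r → ∃ A : 𝒮, ∃ b,
        ∀ i, (0 < r i ↔ 0 < sgn b * lineGenerator F (A.1.image (ext x)) i) ∧
          (r i < 0 ↔ sgn b * lineGenerator F (A.1.image (ext x)) i < 0) := by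
      intro r hr
      obtain ⟨T, hTV, hTD, c, hc, hrc⟩ := hr.eq_smul_lineGenerator hF
      obtain ⟨A, -, hAinj, rfl⟩ := exists_subset_injOn_image_eq_of_surjOn (f := ext x) Set.univ T
        (fun t ht => by
          obtain ⟨a, -, ha⟩ := mem_image.1 (hTV ht)
          exact ⟨a, Set.mem_univ a, ha⟩)
      rw [card_image_of_injOn hAinj] at hTD
      refine ⟨⟨A, mem_filter.2 ⟨mem_powerset.2 (subset_univ _), hTD⟩⟩, decide (0 < c), fun i => ?_⟩
      have hri : r i = c * lineGenerator F (A.image (ext x)) i := by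
        conv_lhs => rw [hrc]
        rfl
      rcases lt_or_gt_of_ne hc with h | h
      · have h' : ¬ 0 < c := not_lt.2 h.le
        simp only [sgn, h', decide_false, hri]
        simp [mul_pos_iff, mul_neg_iff, h, h']
      · have h' : ¬ c < 0 := not_lt.2 h.le
        simp only [sgn, h, decide_true, hri]
        simp [mul_neg_iff, h, h']
    obtain ⟨A, b, hA⟩ := key r hr
    obtain ⟨A', b', hA'⟩ := key r' hr'
    have hSeq : S ((A, A'), (b, b')) x = ({i | 0 < r i ∧ r' i < 0} : Finset ι) := by
      ext i
      simp only [S, mem_filter, mem_univ, true_and]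
      rw [(hA i).1, (hA' i).2]
    have hq := hx ((A, A'), (b, b'))
    rw [hSeq] at hq
    rcases hq with hq | ⟨i, hi⟩
    · rw [card_compl, Nat.cast_sub (card_le_univ _)] at hq
      have h1 : (#{i | 0 < r i ∧ r' i < 0} : ℝ) < 1 / (4 * ((D : ℝ) + 1) ^ 2) * Fintype.card ι := by
        linarith
      rw [one_div, inv_mul_eq_div, lt_div_iff₀ (by positivity)] at h1
      have h2 : ((4 * (D + 1) ^ 2 * #{i | 0 < r i ∧ r' i < 0} : ℕ) : ℝ) ≤ (Fintype.card ι : ℕ) := by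
        push_cast
        linarith
      exact_mod_cast h2
    · obtain ⟨h1, h2⟩ := (mem_filter.1 hi).2
      exact absurd (hno _ (mem_image.2 ⟨Sum.inl i, mem_univ _, rfl⟩) h1) (not_le.2 h2)

/-- A family of containers, of size independent of the number of points, for the light positivity
sets of the members of a space of functions. -/
theorem exists_containers [Fintype ι] {D : ℕ} (hF : Module.finrank ℝ F ≤ D) :
    ∃ 𝒞 : Finset (Finset ι), #𝒞 ≤ (128 * (D + 1) ^ 4) ^ (2 * D) ∧
      ∀ p ∈ F, (∀ i, p i ≠ 0) → 2 * #{i | 0 < p i} ≤ Fintype.card ι →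
        ∃ C ∈ 𝒞, (∀ i, 0 < p i → i ∈ C) ∧ 4 * #C ≤ 3 * Fintype.card ι := by
  classical
  cases isEmpty_or_nonempty ι
  · refine ⟨{∅}, ?_, fun p _ _ _ => ⟨∅, by simp, by simp, by simp⟩⟩
    rw [card_singleton]
    exact Nat.one_le_pow _ _ (by positivity)
  obtain ⟨V, hVne, hVcard, hV, hwedge⟩ := exists_net hF
  -- A container depends only on a pattern on `V` and D points of `V`, which is what bounds their
  -- number.
  let container : Finset ι × (Fin D → V) → Finset ι := fun a =>
    (flagVertices F V a.1 ∅ (List.ofFn fun k => (a.2 k : ι))).biUnion fun r => {i | 0 < r i}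
  refine ⟨(traces F V ×ˢ univ).image container, ?_, ?_⟩
  · refine card_image_le.trans ?_
    rw [card_product, card_univ, Fintype.card_fun, Fintype.card_fin, Fintype.card_coe]
    have h1 : #V + 1 ≤ 128 * (D + 1) ^ 4 := by
      have : D + 1 ≤ (D + 1) ^ 4 := Nat.le_self_pow (by norm_num) _
      omega
    calc #(traces F V) * #V ^ D ≤ (#V + 1) ^ D * (#V + 1) ^ D := by
          gcongr
          · exact card_traces_le F hF V
          · omega
      _ = (#V + 1) ^ (2 * D) := by rw [two_mul, pow_add]
      _ ≤ _ := by gcongr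
  · intro p hp hp0 hlight
    set W : Finset ι := {i ∈ V | 0 < p i} with hW
    have hWtr : W ∈ traces F V := by
      refine mem_filter.2 ⟨mem_powerset.2 (filter_subset _ _), p, hp, fun i hi => ?_⟩
      simp [hW, hi]
    have hpcell : p ∈ cell F V W ∅ := by
      refine ⟨hp, fun i hi => ⟨fun h => (mem_filter.1 h).2.le, fun h => ?_⟩, by simp⟩
      by_contra! hlt
      exact h (mem_filter.2 ⟨hi, hlt⟩)
    obtain ⟨l, hl, hlV, hsign⟩ := exists_flag hV hVne D ∅ (by simp) p hpcell
      ((Submodule.finrank_mono (vanishing_le F ∅)).trans hF)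
    set G := flagVertices F V W ∅ l with hG
    have hGcard : #G ≤ D + 1 := hl ▸ card_flagVertices_le V W ∅ l
    obtain ⟨f, hf⟩ : ∃ f : Fin D → V, l = List.ofFn fun k => (f k : ι) := by
      subst hl
      exact ⟨fun k => ⟨l.get k, hlV _ (List.get_mem _ _)⟩, by simp⟩
    refine ⟨container (W, f), mem_image_of_mem _ (mem_product.2 ⟨hWtr, mem_univ _⟩), ?_, ?_⟩
    · intro i hi
      obtain ⟨r, hr, hri⟩ := (hsign i).1 hi
      refine mem_biUnion.2 ⟨r, ?_, by simpa using hri⟩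
      rw [← hf]
      exact hr
    -- Where p < 0, some vertex r' of the flag is negative, so an excess point lies in one of at
    -- most (D + 1)² wedges, each with at most a fraction 1/(4(D + 1)²) of the points.
    · have hsub : container (W, f) ⊆ ({i | 0 < p i} : Finset ι) ∪
          (G ×ˢ G).biUnion fun a => {i | 0 < a.1 i ∧ a.2 i < 0} := by
        intro i hi
        obtain ⟨r, hr, hri⟩ := mem_biUnion.1 hi
        rw [← hf] at hr
        rcases lt_or_gt_of_ne (hp0 i) with h | h
        · obtain ⟨r', hr', hri'⟩ := (hsign i).2 h
          refine mem_union_right _ (mem_biUnion.2 ⟨(r, r'), mem_product.2 ⟨hr, hr'⟩, ?_⟩)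
          simp only [mem_filter, mem_univ, true_and] at hri ⊢
          exact ⟨hri, hri'⟩
        · exact mem_union_left _ (by simpa using h)
      have hpair : ∀ a ∈ G ×ˢ G, 4 * (D + 1) ^ 2 * #{i | 0 < a.1 i ∧ a.2 i < 0} ≤
          Fintype.card ι := by
        rintro ⟨r, r'⟩ ha
        obtain ⟨hr, hr'⟩ := mem_product.1 ha
        by_cases hr0 : r = 0
        · simp [hr0]
        by_cases hr0' : r' = 0
        · simp [hr0']
        obtain ⟨hc, hv⟩ := mem_flagVertices hr
        obtain ⟨hc', hv'⟩ := mem_flagVertices hr'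
        -- At a point of `V` with r > 0 the common pattern `W` forces r' ≥ 0.
        refine hwedge r r' (hv hr0) (hv' hr0') fun i hi hri => (hc'.2.1 i hi).1 ?_
        by_contra hiW
        exact absurd ((hc.2.1 i hi).2 hiW) (not_le.2 hri)
      have hsum : 4 * (D + 1) ^ 2 * #((G ×ˢ G).biUnion fun a => ({i | 0 < a.1 i ∧ a.2 i < 0} :
          Finset ι)) ≤ (D + 1) ^ 2 * Fintype.card ι := by
        calc _ ≤ 4 * (D + 1) ^ 2 * ∑ a ∈ G ×ˢ G, #{i | 0 < a.1 i ∧ a.2 i < 0} :=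
              Nat.mul_le_mul_left _ card_biUnion_le
          _ = ∑ a ∈ G ×ˢ G, 4 * (D + 1) ^ 2 * #{i | 0 < a.1 i ∧ a.2 i < 0} := mul_sum _ _ _
          _ ≤ ∑ a ∈ G ×ˢ G, Fintype.card ι := sum_le_sum hpair
          _ = #G * #G * Fintype.card ι := by rw [sum_const, card_product, smul_eq_mul]
          _ ≤ (D + 1) * (D + 1) * Fintype.card ι := by gcongr
          _ = _ := by ring
      have hsum' : 4 * #((G ×ˢ G).biUnion fun a => ({i | 0 < a.1 i ∧ a.2 i < 0} :
          Finset ι)) ≤ Fintype.card ι := by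
        refine le_of_mul_le_mul_left (a := (D + 1) ^ 2) ?_ (pow_pos D.succ_pos 2)
        calc _ = _ := by ring
          _ ≤ _ := hsum
      have := (card_le_card hsub).trans (card_union_le _ _)
      omega

end Subspace

/-! ### Combining protocols -/

section Protocol

variable {X Y Z : Type}

/-- Alice sends an element of a type with at most `2 ^ k` elements, using `k` bits. -/
theorem exists_alice_send {α : Type} [Fintype α] [Nonempty α] {k c : ℕ}
    (hk : Fintype.card α ≤ 2 ^ k) (f : X → α) (P : α → Protocol X Y Z) (hP : ∀ a, (P a).cost ≤ c) :
    ∃ Q : Protocol X Y Z, Q.cost ≤ k + c ∧ ∀ x y, Q.run x y = (P (f x)).run x y := by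
  suffices h : ∀ k, ∀ (f : X → Fin k → Bool) (P : (Fin k → Bool) → Protocol X Y Z),
      (∀ a, (P a).cost ≤ c) →
      ∃ Q : Protocol X Y Z, Q.cost ≤ k + c ∧ ∀ x y, Q.run x y = (P (f x)).run x y by
    obtain ⟨e⟩ : Nonempty (α ↪ (Fin k → Bool)) :=
      Function.Embedding.nonempty_of_card_le (by simpa using hk)
    obtain ⟨Q, hQ, hrun⟩ := h k (fun x => e (f x)) (fun a => P (Function.invFun e a))
      (fun a => hP _)
    refine ⟨Q, hQ, fun x y => ?_⟩
    rw [hrun, Function.leftInverse_invFun e.injective]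
  intro k
  induction k with
  | zero =>
    intro f P hP
    refine ⟨P Fin.elim0, by simpa using hP _, fun x y => ?_⟩
    rw [Subsingleton.elim (f x) Fin.elim0]
  | succ k ih =>
    intro f P hP
    choose Q hQ hrun using fun b : Bool =>
      ih (fun x => Fin.tail (f x)) (fun a => P (Fin.cons b a)) (fun a => hP _)
    refine ⟨.alice (fun x => f x 0) Q, ?_, fun x y => ?_⟩
    · have h1 := hQ false
      have h2 := hQ true
      simp only [Protocol.cost]
      omega
    · rw [Protocol.run, hrun, Fin.cons_self_tail]

/-- Exchange the roles of the two players. -/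
def Protocol.swap : Protocol X Y Z → Protocol Y X Z
  | .leaf z => .leaf z
  | .alice bit next => .bob bit fun b => (next b).swap
  | .bob bit next => .alice bit fun b => (next b).swap

theorem Protocol.run_swap (P : Protocol X Y Z) (x : X) (y : Y) : P.swap.run y x = P.run x y := by
  induction P with
  | leaf z => rfl
  | alice bit next ih => exact ih _
  | bob bit next ih => exact ih _

theorem Protocol.cost_swap (P : Protocol X Y Z) : P.swap.cost = P.cost := by
  induction P with
  | leaf z => rfl
  | alice bit next ih => simp only [Protocol.swap, Protocol.cost, ih]
  | bob bit next ih => simp only [Protocol.swap, Protocol.cost, ih]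

/-- Bob sends an element of a type with at most `2 ^ k` elements, using `k` bits. -/
theorem exists_bob_send {α : Type} [Fintype α] [Nonempty α] {k c : ℕ}
    (hk : Fintype.card α ≤ 2 ^ k) (f : Y → α) (P : α → Protocol X Y Z) (hP : ∀ a, (P a).cost ≤ c) :
    ∃ Q : Protocol X Y Z, Q.cost ≤ k + c ∧ ∀ x y, Q.run x y = (P (f y)).run x y := by
  obtain ⟨Q, hQ, hrun⟩ := exists_alice_send (Y := X) hk f (fun a => (P a).swap)
    (fun a => by rw [Protocol.cost_swap]; exact hP a)
  refine ⟨Q.swap, by rwa [Protocol.cost_swap], fun x y => ?_⟩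
  rw [Protocol.run_swap, hrun, Protocol.run_swap]

/-- Run `P` and continue with a protocol that depends on its output. -/
def Protocol.bind {Z' : Type} (Q : Z → Protocol X Y Z') : Protocol X Y Z → Protocol X Y Z'
  | .leaf z => Q z
  | .alice bit next => .alice bit fun b => (next b).bind Q
  | .bob bit next => .bob bit fun b => (next b).bind Q

theorem Protocol.run_bind {Z' : Type} (Q : Z → Protocol X Y Z') (P : Protocol X Y Z)
    (x : X) (y : Y) : (P.bind Q).run x y = (Q (P.run x y)).run x y := by
  induction P with
  | leaf z => rfl
  | alice bit next ih => exact ih _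
  | bob bit next ih => exact ih _

theorem Protocol.cost_bind_le {Z' : Type} {Q : Z → Protocol X Y Z'} {c : ℕ}
    (hQ : ∀ z, (Q z).cost ≤ c) (P : Protocol X Y Z) : (P.bind Q).cost ≤ P.cost + c := by
  induction P with
  | leaf z => simpa [Protocol.bind, Protocol.cost] using hQ z
  | alice bit next ih =>
    have h1 := ih false
    have h2 := ih true
    simp only [Protocol.bind, Protocol.cost]
    omega
  | bob bit next ih =>
    have h1 := ih false
    have h2 := ih true
    simp only [Protocol.bind, Protocol.cost]
    omega

end Protocol

/-! ### The learning protocols -/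

section Learning

variable {ι : Type} [Fintype ι] {F : Submodule ℝ (ι → ℝ)} {D : ℕ}

/-- Containers relative to a set of active points. -/
theorem exists_containers_within (hF : Module.finrank ℝ F ≤ D) (A : Finset ι) :
    ∃ 𝒞 : Finset (Finset ι), #𝒞 ≤ (128 * (D + 1) ^ 4) ^ (2 * D) ∧
      ∀ p ∈ F, (∀ i ∈ A, p i ≠ 0) → 2 * #{i ∈ A | 0 < p i} ≤ #A →
        ∃ C ∈ 𝒞, C ⊆ A ∧ (∀ i ∈ A, 0 < p i → i ∈ C) ∧ 4 * #C ≤ 3 * #A := by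
  classical
  let res : (ι → ℝ) →ₗ[ℝ] (A → ℝ) := LinearMap.funLeft ℝ ℝ Subtype.val
  obtain ⟨𝒞, hcard, h𝒞⟩ := exists_containers (F := F.map res) (D := D)
    ((Submodule.finrank_map_le res F).trans hF)
  refine ⟨𝒞.image fun C => C.map (Function.Embedding.subtype _), card_image_le.trans hcard, ?_⟩
  intro p hp hp0 hlight
  obtain ⟨C, hC, hpC, hCcard⟩ := h𝒞 (res p) (Submodule.mem_map_of_mem hp)
    (fun i => hp0 i i.2) (by
      rw [Fintype.card_coe]
      refine le_trans (Nat.mul_le_mul_left 2 ?_) hlight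
      refine card_le_card_of_injOn Subtype.val (fun i hi => ?_) Subtype.val_injective.injOn
      have hi' : 0 < p i := (mem_filter.1 hi).2
      simpa using hi')
  refine ⟨_, mem_image_of_mem _ hC, fun i hi => ?_, fun i hi hpi => ?_, ?_⟩
  · obtain ⟨j, -, rfl⟩ := mem_map.1 hi
    exact j.2
  · exact mem_map.2 ⟨⟨i, hi⟩, hpC ⟨i, hi⟩ hpi, rfl⟩
  · rw [card_map]
    simpa using hCcard

/-- Learning a separator of Alice's points from Bob's points. -/
theorem exists_protocol_separating {X Y : Type} (sx : X → Set ι) (sy : Y → Set ι)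
    (hF : Module.finrank ℝ F ≤ D) {k : ℕ} (hk : (128 * (D + 1) ^ 4) ^ (2 * D) + 1 ≤ 2 ^ k)
    (T : ℕ) (A : Finset ι) (hA : 3 ^ T * #A < 4 ^ T) :
    ∃ P : Protocol X Y (ι → ℤˣ), P.cost ≤ 2 * k * T ∧ ∀ x y,
      (∃ p ∈ F, (∀ i ∈ A, p i ≠ 0) ∧ (∀ i ∈ sx x, 0 < p i) ∧ ∀ i ∈ sy y, p i < 0) →
      ∀ i ∈ A, (i ∈ sx x → P.run x y i = 1) ∧ (i ∈ sy y → P.run x y i = -1) := by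
  classical
  induction T generalizing A with
  | zero =>
    have : A = ∅ := by simpa using hA
    subst this
    exact ⟨.leaf 1, by simp [Protocol.cost], by simp⟩
  | succ T ih =>
    obtain ⟨𝒞, hcard, h𝒞⟩ := exists_containers_within hF A
    let good : Finset ι → Prop := fun C => C ⊆ A ∧ 4 * #C ≤ 3 * #A
    -- Sets that are not good get a trivial protocol, so that the cost bound holds for every
    -- message.
    have hrec : ∀ C : Finset ι, ∃ P : Protocol X Y (ι → ℤˣ), P.cost ≤ 2 * k * T ∧ (good C → ∀ x y,
      (∃ p ∈ F, (∀ i ∈ A, p i ≠ 0) ∧ (∀ i ∈ sx x, 0 < p i) ∧ ∀ i ∈ sy y, p i < 0) →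
      ∀ i ∈ C, (i ∈ sx x → P.run x y i = 1) ∧ (i ∈ sy y → P.run x y i = -1)) := by
      intro C
      by_cases hC : good C
      · obtain ⟨P, hP, h⟩ := ih C (by
          have h1 : 3 ^ T * (4 * #C) ≤ 3 ^ T * (3 * #A) := Nat.mul_le_mul_left _ hC.2
          rw [pow_succ, pow_succ] at hA
          nlinarith)
        refine ⟨P, hP, fun _ x y ⟨p, hp, h0, h1⟩ => h x y ⟨p, hp, fun i hi => h0 i (hC.1 hi), h1⟩⟩
      · exact ⟨.leaf 1, by simp [Protocol.cost], fun h => absurd h hC⟩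
    choose P hPcost hP using hrec
    -- Outside a container of Alice's points the label -1 is safe, and outside one of Bob's the
    -- label 1.
    let out : Finset ι → ℤˣ → (ι → ℤˣ) → ι → ℤˣ := fun C s g i => if i ∈ C then g i else s
    let tail : Finset ι → ℤˣ → Protocol X Y (ι → ℤˣ) := fun C s =>
      (P C).bind fun g => .leaf (out C s g)
    have htail : ∀ C s, (tail C s).cost ≤ 2 * k * T := fun C s =>
      (Protocol.cost_bind_le (c := 0) (fun _ => le_rfl) _).trans (hPcost C)
    have hrun : ∀ C s x y, (tail C s).run x y = out C s ((P C).run x y) := fun C s x y =>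
      Protocol.run_bind _ _ _ _
    have hk𝒞 : Fintype.card (Option 𝒞) ≤ 2 ^ k := by
      rw [Fintype.card_option, Fintype.card_coe]
      omega
    have hpick : ∀ s : Set ι, ∃ o : Option 𝒞,
        (∀ C, o = some C → good C ∧ ∀ i ∈ A, i ∈ s → i ∈ C.1) ∧
        (o = none → ¬ ∃ C ∈ 𝒞, good C ∧ ∀ i ∈ A, i ∈ s → i ∈ C) := by
      intro s
      by_cases h : ∃ C ∈ 𝒞, good C ∧ ∀ i ∈ A, i ∈ s → i ∈ C
      · obtain ⟨C, hC, h⟩ := h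
        refine ⟨some ⟨C, hC⟩, fun C' hC' => ?_, by simp⟩
        simp only [Option.some.injEq] at hC'
        rw [← hC']
        exact h
      · exact ⟨none, by simp, fun _ => h⟩
    choose pick hpick_some hpick_none using hpick
    obtain ⟨PB, hPB, hPBrun⟩ := exists_bob_send (X := X) hk𝒞 (fun y => pick (sy y))
      (fun o => o.elim (.leaf 1) fun C => tail C 1) (c := 2 * k * T) (by
        rintro (_ | C)
        · simp [Protocol.cost]
        · exact htail _ _)
    obtain ⟨PA, hPA, hPArun⟩ := exists_alice_send (Y := Y) hk𝒞 (fun x => pick (sx x))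
      (fun o => o.elim PB fun C => tail C (-1)) (c := k + 2 * k * T) (by
        rintro (_ | C)
        · exact hPB
        · exact (htail _ _).trans (Nat.le_add_left _ _))
    refine ⟨PA, hPA.trans (le_of_eq (by ring)), fun x y hxy i hi => ?_⟩
    rw [hPArun]
    rcases hox : pick (sx x) with _ | C
    · simp only [Option.elim_none]
      rw [hPBrun]
      rcases hoy : pick (sy y) with _ | C
      -- Positive and negative sides are disjoint in A, so one of them is light and its owner has a
      -- container.
      · exfalso
        obtain ⟨p, hp, hp0, hpx, hpy⟩ := hxy
        have hsplit : #{i ∈ A | 0 < p i} + #{i ∈ A | 0 < (-p) i} ≤ #A := by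
          rw [← card_union_of_disjoint]
          · exact card_le_card (union_subset (filter_subset _ _) (filter_subset _ _))
          · rw [disjoint_filter]
            intro i _ h1 h2
            simp only [Pi.neg_apply] at h2
            linarith
        rcases le_total (2 * #{i ∈ A | 0 < p i}) #A with h | h
        · obtain ⟨C, hC, hCA, hpC, hCc⟩ := h𝒞 p hp hp0 h
          exact hpick_none _ hox ⟨C, hC, ⟨hCA, hCc⟩, fun i hi hix => hpC i hi (hpx i hix)⟩
        · obtain ⟨C, hC, hCA, hpC, hCc⟩ := h𝒞 (-p) (F.neg_mem hp)
            (fun i hi => neg_ne_zero.2 (hp0 i hi)) (by omega)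
          exact hpick_none _ hoy ⟨C, hC, ⟨hCA, hCc⟩, fun i hi hiy => hpC i hi
            (by simpa using hpy i hiy)⟩
      · obtain ⟨hg, hcov⟩ := hpick_some _ _ hoy
        simp only [Option.elim_some]
        rw [hrun]
        simp only [out]
        split_ifs with hiC
        · exact hP _ hg x y hxy i hiC
        · exact ⟨fun _ => rfl, fun h => absurd (hcov i hi h) hiC⟩
    · obtain ⟨hg, hcov⟩ := hpick_some _ _ hox
      simp only [Option.elim_some]
      rw [hrun]
      simp only [out]
      split_ifs with hiC
      · exact hP _ hg x y hxy i hiC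
      · exact ⟨fun h => absurd (hcov i hi h) hiC, fun _ => rfl⟩

/-- Learning from two labelled samples that are jointly separated by a member of `F`. -/
theorem exists_protocol_consistent {X Y : Type} (sx : X → ℤˣ → Set ι) (sy : Y → ℤˣ → Set ι)
    (hF : Module.finrank ℝ F ≤ D) {k K : ℕ} (hk : (128 * (D + 1) ^ 4) ^ (2 * D) + 1 ≤ 2 ^ k)
    (hK : (Fintype.card ι + 1) ^ D ≤ 2 ^ K)
    (T : ℕ) (hT : 3 ^ T * Fintype.card ι < 4 ^ T) :
    ∃ P : Protocol X Y (ι → ℤˣ), P.cost ≤ 4 * k * T + 2 * K ∧ ∀ x y,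
      (∃ p ∈ F, (∀ i, p i ≠ 0) ∧ (∀ i, i ∈ sx x 1 ∨ i ∈ sy y 1 → 0 < p i) ∧
        ∀ i, i ∈ sx x (-1) ∨ i ∈ sy y (-1) → p i < 0) →
      ∀ s i, i ∈ sx x s ∨ i ∈ sy y s → P.run x y i = s := by
  classical
  obtain ⟨P₁, hP₁, h₁⟩ := exists_protocol_separating (fun x => sx x 1) (fun y => sy y (-1)) hF hk T
    univ (by simpa using hT)
  obtain ⟨P₂, hP₂, h₂⟩ := exists_protocol_separating (fun x => sx x (-1)) (fun y => sy y 1) hF hk T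
    univ (by simpa using hT)
  have hne : (traces F (univ : Finset ι)).Nonempty :=
    ⟨∅, mem_filter.2 ⟨by simp, 0, F.zero_mem, by simp⟩⟩
  have : Nonempty (traces F (univ : Finset ι)) := hne.to_subtype
  have hcard : Fintype.card (traces F (univ : Finset ι)) ≤ 2 ^ K := by
    rw [Fintype.card_coe]
    refine (card_traces_le F hF univ).trans ?_
    simpa using hK
  have hfit : ∀ s : ℤˣ → Set ι, ∃ W : traces F (univ : Finset ι),
      (∃ p ∈ F, (∀ i ∈ s 1, 0 < p i) ∧ ∀ i ∈ s (-1), p i < 0) →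
      (∀ i ∈ s 1, i ∈ W.1) ∧ ∀ i ∈ s (-1), i ∉ W.1 := by
    intro s
    by_cases h : ∃ p ∈ F, (∀ i ∈ s 1, 0 < p i) ∧ ∀ i ∈ s (-1), p i < 0
    · obtain ⟨p, hp, h1, h2⟩ := h
      refine ⟨⟨univ.filter fun i => 0 < p i, mem_filter.2 ⟨by simp, p, hp, by simp⟩⟩, fun _ => ⟨?_, ?_⟩⟩
      · intro i hi
        simpa using h1 i hi
      · intro i hi
        simpa using (h2 i hi).le
    · exact ⟨hne.to_subtype.some, fun h' => absurd h' h⟩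
  choose fit hfit using hfit
  -- Alice's positives lie in `WA` with g₁ = 1, Bob's in `WB` with g₂ = -1. Her negatives avoid `WA`
  -- and have g₂ = 1; his avoid `WB` and have g₁ = -1. So each negative example fails both clauses.
  let out (WA WB : Finset ι) (g₁ g₂ : ι → ℤˣ) : ι → ℤˣ := fun i =>
    if (i ∈ WA ∧ g₁ i = 1) ∨ (i ∈ WB ∧ g₂ i = -1) then 1 else -1
  let main (WA WB : Finset ι) : Protocol X Y (ι → ℤˣ) :=
    P₁.bind fun g₁ => P₂.bind fun g₂ => .leaf (out WA WB g₁ g₂)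
  have hmain : ∀ WA WB, (main WA WB).cost ≤ 4 * k * T := by
    intro WA WB
    refine (Protocol.cost_bind_le (c := 2 * k * T) (fun g₁ => ?_) _).trans ?_
    · exact (Protocol.cost_bind_le (c := 0) (fun _ => le_rfl) _).trans hP₂
    · calc _ ≤ 2 * k * T + 2 * k * T := Nat.add_le_add_right hP₁ _
        _ = _ := by ring
  choose Q hQ hQrun using fun WA : traces F (univ : Finset ι) =>
    exists_bob_send hcard (fun y => fit (sy y)) (fun WB => main WA.1 WB.1) (fun _ => hmain _ _)
  obtain ⟨P, hP, hrun⟩ := exists_alice_send hcard (fun x => fit (sx x)) Q hQ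
  refine ⟨P, hP.trans (le_of_eq (by ring)), fun x y ⟨p, hp, hp0, hp1, hp2⟩ s i hs => ?_⟩
  rw [hrun, hQrun]
  simp only [main, Protocol.run_bind, Protocol.run]
  obtain ⟨hA1, hA2⟩ := hfit (sx x) ⟨p, hp, fun i hi => hp1 i (.inl hi), fun i hi => hp2 i (.inl hi)⟩
  obtain ⟨hB1, hB2⟩ := hfit (sy y) ⟨p, hp, fun i hi => hp1 i (.inr hi), fun i hi => hp2 i (.inr hi)⟩
  obtain ⟨e1, e2⟩ := h₁ x y ⟨p, hp, fun i _ => hp0 i, fun i hi => hp1 i (.inl hi),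
    fun i hi => hp2 i (.inr hi)⟩ i (mem_univ i)
  obtain ⟨e3, e4⟩ := h₂ x y ⟨-p, F.neg_mem hp, fun i _ => neg_ne_zero.2 (hp0 i),
    fun i hi => by simpa using hp2 i (.inl hi), fun i hi => by simpa using hp1 i (.inr hi)⟩
    i (mem_univ i)
  have hne1 : (1 : ℤˣ) ≠ -1 := by decide
  simp only [out]
  rcases Int.units_eq_one_or s with rfl | rfl
  · rw [if_pos]
    rcases hs with h | h
    · exact .inl ⟨hA1 i h, e1 h⟩
    · exact .inr ⟨hB1 i h, e4 h⟩
  · rw [if_neg]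
    rintro (⟨hW, hg⟩ | ⟨hW, hg⟩)
    · rcases hs with h | h
      · exact hA2 i h hW
      · exact hne1 (hg.symm.trans (e2 h))
    · rcases hs with h | h
      · exact hne1 ((e3 h).symm.trans hg)
      · exact hB2 i h hW

end Learning

/-! ### Halfspaces as signs of affine functionals -/

section Halfspaces

variable {d : ℕ} (U : Finset (EuclideanSpace ℝ (Fin d)))

/-- Restriction to `U` of the affine functional with the given linear part and constant. -/
noncomputable def affineOn : (EuclideanSpace ℝ (Fin d) × ℝ) →ₗ[ℝ] (U → ℝ) where
  toFun a u := inner ℝ a.1 (u : EuclideanSpace ℝ (Fin d)) + a.2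
  map_add' a b := by
    funext u
    simp only [Prod.fst_add, Prod.snd_add, inner_add_left, Pi.add_apply]
    ring
  map_smul' c a := by
    funext u
    simp only [Prod.smul_fst, Prod.smul_snd, real_inner_smul_left, Pi.smul_apply, smul_eq_mul,
      RingHom.id_apply]
    ring

theorem finrank_range_affineOn_le : Module.finrank ℝ (LinearMap.range (affineOn U)) ≤ d + 1 := by
  refine (LinearMap.finrank_range_le _).trans ?_
  simp

variable {U}

/-- As `U` is finite, the boundary can be moved outwards by less than the gap to every excluded
point. No point then lies on it, as the containers require. -/
theorem Separable.exists_affineOn {S : Sample U} (h : Separable S) :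
    ∃ p ∈ LinearMap.range (affineOn U), (∀ u, p u ≠ 0) ∧ (∀ u, (u, 1) ∈ S → 0 < p u) ∧
      ∀ u, (u, -1) ∈ S → p u < 0 := by
  classical
  obtain ⟨_, ⟨w, b, -, rfl⟩, h1, h2⟩ := h
  simp only [Set.mem_ofPred_eq] at h1 h2
  obtain ⟨δ, hδ, hlt⟩ : ∃ δ > 0, ∀ u : U, inner ℝ w (u : EuclideanSpace ℝ (Fin d)) < b →
      inner ℝ w (u : EuclideanSpace ℝ (Fin d)) + δ < b := by
    have key : ∀ s : Finset U, ∃ δ > 0, ∀ u ∈ s, inner ℝ w (u : EuclideanSpace ℝ (Fin d)) < b →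
      inner ℝ w (u : EuclideanSpace ℝ (Fin d)) + δ < b := by
      intro s
      induction s using Finset.induction_on with
      | empty => exact ⟨1, one_pos, by simp⟩
      | insert a s _ ih =>
        obtain ⟨δ, hδ, h⟩ := ih
        by_cases ha : inner ℝ w (a : EuclideanSpace ℝ (Fin d)) < b
        · refine ⟨min δ ((b - inner ℝ w (a : EuclideanSpace ℝ (Fin d))) / 2),
            lt_min hδ (by linarith), fun u hu hub => ?_⟩
          rcases mem_insert.1 hu with rfl | hu
          · have := min_le_right δ ((b - inner ℝ w (u : EuclideanSpace ℝ (Fin d))) / 2)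
            linarith
          · have := min_le_left δ ((b - inner ℝ w (a : EuclideanSpace ℝ (Fin d))) / 2)
            have := h u hu hub
            linarith
        · refine ⟨δ, hδ, fun u hu hub => ?_⟩
          rcases mem_insert.1 hu with rfl | hu
          · exact absurd hub ha
          · exact h u hu hub
    obtain ⟨δ, hδ, h⟩ := key univ
    exact ⟨δ, hδ, fun u => h u (mem_univ u)⟩
  have hval : ∀ u : U, affineOn U (w, δ - b) u =
      inner ℝ w (u : EuclideanSpace ℝ (Fin d)) + (δ - b) := fun _ => rfl
  refine ⟨affineOn U (w, δ - b), ⟨_, rfl⟩, fun u => ?_, fun u hu => ?_, fun u hu => ?_⟩ <;>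
    rw [hval]
  · rcases lt_or_ge (inner ℝ w (u : EuclideanSpace ℝ (Fin d))) b with h | h
    · have := hlt u h
      exact ne_of_lt (by linarith)
    · exact ne_of_gt (by linarith)
  · linarith [h1 u hu]
  · linarith [hlt u (not_le.1 (h2 u hu))]

theorem natLog_two_mul_log_two_le (n : ℕ) (hn : 1 ≤ n) : (Nat.log 2 n : ℝ) * Real.log 2 ≤ Real.log n := by
  rw [← Real.log_pow]
  refine Real.log_le_log (by positivity) ?_
  exact_mod_cast Nat.pow_log_le_self 2 (by omega)

end Halfspaces

end HalfspaceLearning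

/-! ### The choice of constants -/

theorem theorem1 :
    ∃ C : ℝ, 0 < C ∧ ∀ (d n : ℕ), 1 ≤ d →
      ∀ U : Finset (EuclideanSpace ℝ (Fin d)), U.card = n →
        ∃ P : HalfspaceLearning.Protocol (HalfspaceLearning.Sample U)
            (HalfspaceLearning.Sample U) (U → ℤˣ),
          HalfspaceLearning.LearnsHalfspaces P ∧
          (P.cost : ℝ) ≤ C * d * Real.log (d + 1) * Real.log (n + 1) := by
  refine ⟨8000, by norm_num, fun d n hd U hU => ?_⟩
  -- For n = 0 the bound is 0, so no bit may be sent.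
  rcases Nat.eq_zero_or_pos n with rfl | hn
  · rw [Finset.card_eq_zero] at hU
    subst hU
    exact ⟨.leaf 1, fun _ _ _ e _ => absurd e.1.2 (Finset.notMem_empty _),
      by simp [HalfspaceLearning.Protocol.cost]⟩
  set ℓ := Nat.log 2 (d + 2) with hℓ
  set b := Nat.log 2 n + 1 with hb
  have hnb : n < 2 ^ b := Nat.lt_pow_succ_log_self (by norm_num) n
  have hdℓ : d + 2 < 2 ^ (ℓ + 1) := Nat.lt_pow_succ_log_self (by norm_num) _
  obtain ⟨P, hcost, hP⟩ := HalfspaceLearning.exists_protocol_consistent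
    (X := HalfspaceLearning.Sample U) (Y := HalfspaceLearning.Sample U)
    (fun S s => {u | (u, s) ∈ S}) (fun S s => {u | (u, s) ∈ S})
    (HalfspaceLearning.finrank_range_affineOn_le U)
    -- Here D = d + 1, 128 = 2^7 and d + 2 ≤ 2^(ℓ + 1); the last bit makes room for the message that
    -- no container was found.
    (k := (7 + 4 * (ℓ + 1)) * (2 * (d + 1)) + 1) (K := b * (d + 1)) (by
      have h1 : 128 * (d + 1 + 1) ^ 4 ≤ 2 ^ (7 + 4 * (ℓ + 1)) := by
        rw [pow_add, mul_comm 4, pow_mul]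
        exact Nat.mul_le_mul (by norm_num) (Nat.pow_le_pow_left hdℓ.le 4)
      have h2 := Nat.pow_le_pow_left h1 (2 * (d + 1))
      rw [← pow_mul] at h2
      have h3 := Nat.one_le_two_pow (n := (7 + 4 * (ℓ + 1)) * (2 * (d + 1)))
      rw [pow_succ 2, mul_two]
      exact Nat.add_le_add h2 h3)
    (by
      rw [Fintype.card_coe, hU, pow_mul]
      exact Nat.pow_le_pow_left hnb _)
    -- Three rounds more than halve the active set, as 2 · 3³ = 54 < 64 = 4³.
    (3 * b) (by
      rw [Fintype.card_coe, hU, pow_mul, pow_mul]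
      calc (3 ^ 3) ^ b * n < (3 ^ 3) ^ b * 2 ^ b := by gcongr
        _ = 54 ^ b := by rw [← mul_pow]; norm_num
        _ ≤ (4 ^ 3) ^ b := Nat.pow_le_pow_left (by norm_num) _)
  refine ⟨P, fun Sa Sb hsep e he => ?_, ?_⟩
  · obtain ⟨p, hp, hp0, hp1, hp2⟩ := hsep.exists_affineOn
    exact hP Sa Sb ⟨p, hp, hp0, hp1, hp2⟩ e.2 e.1 he
  · have hlog2 : (1 / 2 : ℝ) ≤ Real.log 2 := by linarith [Real.log_two_gt_d9]
    have hdR : (1 : ℝ) ≤ d := by exact_mod_cast hd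
    have hnR : (1 : ℝ) ≤ n := by exact_mod_cast hn
    set x := Real.log (d + 1) with hx
    set z := Real.log (n + 1) with hz
    have hx1 : (1 / 2 : ℝ) ≤ x := hlog2.trans (Real.log_le_log (by norm_num) (by linarith))
    have hz1 : (1 / 2 : ℝ) ≤ z := hlog2.trans (Real.log_le_log (by norm_num) (by linarith))
    have hℓx : (ℓ : ℝ) ≤ 4 * x := by
      have h1 := HalfspaceLearning.natLog_two_mul_log_two_le (d + 2) (by omega)
      have h2 : Real.log ((d + 2 : ℕ) : ℝ) ≤ 2 * x := by
        rw [hx, ← Nat.cast_ofNat (R := ℝ), ← Real.log_pow]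
        refine Real.log_le_log (by positivity) ?_
        push_cast
        nlinarith
      have h3 : (ℓ : ℝ) * (1 / 2) ≤ ℓ * Real.log 2 := by gcongr
      linarith
    have hbz : (b : ℝ) ≤ 4 * z := by
      have h1 := HalfspaceLearning.natLog_two_mul_log_two_le n hn
      have h2 : Real.log n ≤ z := Real.log_le_log (by linarith) (by linarith)
      have h3 : (Nat.log 2 n : ℝ) * (1 / 2) ≤ Nat.log 2 n * Real.log 2 := by gcongr
      rw [hb]
      push_cast
      linarith
    have hcost' : (P.cost : ℝ) ≤ 4 * ((7 + 4 * (ℓ + 1)) * (2 * (d + 1)) + 1) * (3 * b) +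
        2 * (b * (d + 1)) := by exact_mod_cast hcost
    calc (P.cost : ℝ) ≤ _ := hcost'
      _ = (12 * ((7 + 4 * (ℓ + 1)) * (2 * (d + 1)) + 1) + 2 * (d + 1)) * b := by ring
      _ ≤ ((d + 1) * (278 + 96 * ℓ)) * b := by
          gcongr
          nlinarith
      -- Since x ≥ 1/2, 278 ≤ 556x, and 96ℓ ≤ 384x.
      _ ≤ ((2 * d) * (940 * x)) * (4 * z) := by
          gcongr
          · linarith
          · linarith
      _ ≤ 8000 * d * x * z := by
          have : 0 ≤ (d : ℝ) * x * z := by positivity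
          linarith
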